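/- Let $B$ be a unital C*-algebra, let $m,k$ be natural numbers, and let $\{\sigma_{a|x}\}$, $a=1,\dots,k$, $x=1,\dots,m$, be a collection of positive linear functionals on $B$. A family $(P_{a|x})$ in a unital C*-algebra $A$ consists of PVM elements if every $P_{a|x}$ is a self-adjoint projection, $P_{a|x}=P_{a|x}^*=P_{a|x}^2$, and $\sum_{a=1}^k P_{a|x}=\mathbb{1}$ for every $x$; a family $(M_{a|x})$ in $A$ consists of POVM elements if every $M_{a|x}$ is positive and $\sum_{a=1}^k M_{a|x}=\mathbb{1}$ for every $x$. Let $C^*(m,k)$ be the universal unital C*-algebra generated by elements $P_{a|x}$ subject to the relations $P_{a|x}=P_{a|x}^*=P_{a|x}^2$ and $\sum_{a=1}^k P_{a|x}=\mathbb{1}$. Write $A\otimes_{min}B$ for the minimal (spatial) tensor product, the completion of the algebraic tensor product in the norm $\|z\|_{min}=\sup\|(\pi\otimes\rho)(z)\|$ over all unital $*$-representations $\pi$ of $A$ and $\rho$ of $B$ on Hilbert spaces, and $S(D)$ for the set of states (positive linear functionals $\phi$ with $\phi(\mathbb{1})=1$) on a unital C*-algebra $D$. Then the following conditions are equivalent: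 \begin{enumerate} \item there is a state $\phi\in S(C^*(m,k)\otimes_{min}B)$ such that $\sigma_{a|x}(b)=\phi(P_{a|x}\otimes b)$ for all $a$, $x$ and all $b\in B$, where $P_{a|x}$ are the generating projections of $C^*(m,k)$; \item there are a unital C*-algebra $A$, a state $\phi\in S(A\otimes_{min}B)$ and PVM elements $P_{a|x}\in A$ such that $\sigma_{a|x}(b)=\phi(P_{a|x}\otimes b)$ for all $a$, $x$ and all $b\in B$; \item there are a unital C*-algebra $A$, a state $\phi\in S(A\otimes_{min}B)$ and POVM elements $M_{a|x}\in A$ such that $\sigma_{a|x}(b)=\phi(M_{a|x}\otimes b)$ for all $a$, $x$ and all $b\in B$. \end{enumerate} -/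

import Mathlib

open scoped TensorProduct ComplexOrder

universe u v

noncomputable section

/-! ### C⋆-seminorms and the associated C⋆-algebras -/

/-- A C⋆-seminorm on a complex unital ⋆-algebra: a submultiplicative seminorm that satisfies the
C⋆-identity. -/
structure CStarSeminorm (R : Type u) [Ring R] [StarRing R] [Algebra ℂ R]
    extends Seminorm ℂ R where
  mul_le' : ∀ x y : R, toFun (x * y) ≤ toFun x * toFun y
  star_mul_self' : ∀ x : R, toFun (star x * x) = toFun x ^ 2

namespace CStarSeminorm

variable {R : Type u} [Ring R] [StarRing R] [Algebra ℂ R]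

instance : CoeFun (CStarSeminorm R) (fun _ => R → ℝ) := ⟨fun p => p.toSeminorm⟩

theorem mul_le (p : CStarSeminorm R) (x y : R) : p (x * y) ≤ p x * p y := p.mul_le' x y

theorem star_mul_self (p : CStarSeminorm R) (x : R) : p (star x * x) = p x ^ 2 :=
  p.star_mul_self' x

theorem nonneg (p : CStarSeminorm R) (x : R) : 0 ≤ p x := apply_nonneg p.toSeminorm x

theorem le_star (p : CStarSeminorm R) (x : R) : p x ≤ p (star x) := by
  rcases (p.nonneg x).eq_or_lt with h | h
  · rw [← h]; exact p.nonneg _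
  · have h1 := p.mul_le (star x) x
    rw [p.star_mul_self, pow_two] at h1
    exact le_of_mul_le_mul_right h1 h

theorem map_star (p : CStarSeminorm R) (x : R) : p (star x) = p x :=
  le_antisymm (by simpa using p.le_star (star x)) (p.le_star x)

theorem map_one_le (p : CStarSeminorm R) : p 1 ≤ 1 := by
  have h := p.star_mul_self 1
  rw [star_one, mul_one] at h
  nlinarith [p.nonneg 1]

/-- The pointwise supremum of a pointwise bounded set of C⋆-seminorms. -/
def sSupOf (F : Set (CStarSeminorm R))
    (hF : ∀ x : R, BddAbove ((fun p : CStarSeminorm R => p x) '' F)) : CStarSeminorm R where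
  toSeminorm := Seminorm.of (fun x => sSup ((fun p : CStarSeminorm R => p x) '' F))
    (fun x y => by
      have hx : 0 ≤ sSup ((fun p : CStarSeminorm R => p x) '' F) :=
        Real.sSup_nonneg (by rintro _ ⟨p, -, rfl⟩; exact p.nonneg x)
      have hy : 0 ≤ sSup ((fun p : CStarSeminorm R => p y) '' F) :=
        Real.sSup_nonneg (by rintro _ ⟨p, -, rfl⟩; exact p.nonneg y)
      refine Real.sSup_le ?_ (add_nonneg hx hy)
      rintro _ ⟨p, hp, rfl⟩
      exact (map_add_le_add p.toSeminorm x y).trans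
        (add_le_add (le_csSup (hF x) ⟨p, hp, rfl⟩) (le_csSup (hF y) ⟨p, hp, rfl⟩)))
    (fun c x => by
      rw [← smul_eq_mul, ← Real.sSup_smul_of_nonneg (norm_nonneg c)]
      congr 1
      ext r
      simp only [Set.mem_image, Set.mem_smul_set, exists_exists_and_eq_and, smul_eq_mul]
      simp [map_smul_eq_mul])
  mul_le' := fun x y => by
    have hx : 0 ≤ sSup ((fun p : CStarSeminorm R => p x) '' F) :=
      Real.sSup_nonneg (by rintro _ ⟨p, -, rfl⟩; exact p.nonneg x)
    have hy : 0 ≤ sSup ((fun p : CStarSeminorm R => p y) '' F) :=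
      Real.sSup_nonneg (by rintro _ ⟨p, -, rfl⟩; exact p.nonneg y)
    refine Real.sSup_le ?_ (mul_nonneg hx hy)
    rintro _ ⟨p, hp, rfl⟩
    exact (p.mul_le x y).trans
      (mul_le_mul (le_csSup (hF x) ⟨p, hp, rfl⟩) (le_csSup (hF y) ⟨p, hp, rfl⟩) (p.nonneg y) hx)
  star_mul_self' := fun x => by
    have hx : 0 ≤ sSup ((fun p : CStarSeminorm R => p x) '' F) :=
      Real.sSup_nonneg (by rintro _ ⟨p, -, rfl⟩; exact p.nonneg x)
    refine le_antisymm (Real.sSup_le ?_ (sq_nonneg _)) ?_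
    · rintro _ ⟨p, hp, rfl⟩
      change p (star x * x) ≤ _
      rw [p.star_mul_self]
      exact pow_le_pow_left₀ (p.nonneg x) (le_csSup (hF x) ⟨p, hp, rfl⟩) 2
    · have hT : 0 ≤ sSup ((fun p : CStarSeminorm R => p (star x * x)) '' F) :=
        Real.sSup_nonneg (by rintro _ ⟨p, -, rfl⟩; exact p.nonneg _)
      have h : sSup ((fun p : CStarSeminorm R => p x) '' F) ≤
          √(sSup ((fun p : CStarSeminorm R => p (star x * x)) '' F)) := by
        refine Real.sSup_le ?_ (Real.sqrt_nonneg _)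
        rintro _ ⟨p, hp, rfl⟩
        refine Real.le_sqrt_of_sq_le ?_
        rw [← p.star_mul_self]
        exact le_csSup (hF _) ⟨p, hp, rfl⟩
      calc _ ≤ (√(sSup ((fun p : CStarSeminorm R => p (star x * x)) '' F))) ^ 2 :=
            pow_le_pow_left₀ hx h 2
        _ = _ := Real.sq_sqrt hT

/-- The C⋆-seminorm `x ↦ ‖f x‖` given by a ⋆-homomorphism `f` into a C⋆-algebra. -/
def ofStarAlgHom {C : Type v} [CStarAlgebra C] (f : R →⋆ₐ[ℂ] C) : CStarSeminorm R where
  toSeminorm := (normSeminorm ℂ C).comp f.toAlgHom.toLinearMap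
  mul_le' := fun x y => by
    change ‖f (x * y)‖ ≤ ‖f x‖ * ‖f y‖
    rw [map_mul]
    exact norm_mul_le _ _
  star_mul_self' := fun x => by
    change ‖f (star x * x)‖ = ‖f x‖ ^ 2
    rw [map_mul, StarHomClass.map_star, CStarRing.norm_star_mul_self, pow_two]

@[simp]
theorem ofStarAlgHom_apply {C : Type v} [CStarAlgebra C] (f : R →⋆ₐ[ℂ] C) (x : R) :
    ofStarAlgHom f x = ‖f x‖ := rfl

theorem sSupOf_apply (F : Set (CStarSeminorm R))
    (hF : ∀ x : R, BddAbove ((fun p : CStarSeminorm R => p x) '' F)) (x : R) :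
    sSupOf F hF x = sSup ((fun p : CStarSeminorm R => p x) '' F) := rfl

/-- The ⋆-algebra `R`, viewed as a seminormed algebra through the C⋆-seminorm `p`. -/
@[nolint unusedArguments]
def Space (_p : CStarSeminorm R) : Type u := R

section Space

variable (p : CStarSeminorm R)

instance : Ring p.Space := inferInstanceAs (Ring R)
instance : StarRing p.Space := inferInstanceAs (StarRing R)
instance : Algebra ℂ p.Space := inferInstanceAs (Algebra ℂ R)
instance [StarModule ℂ R] : StarModule ℂ p.Space := inferInstanceAs (StarModule ℂ R)

instance : SeminormedRing p.Space :=
  { (inferInstance : Ring p.Space), p.toSeminorm.toAddGroupSeminorm.toSeminormedAddCommGroup with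
    norm_mul_le := p.mul_le }

instance : NormedAlgebra ℂ p.Space where
  norm_smul_le c x := le_of_eq (map_smul_eq_mul p.toSeminorm c x)

theorem norm_def (x : p.Space) : ‖x‖ = p x := rfl

theorem norm_star_space (x : p.Space) : ‖star x‖ = ‖x‖ := p.map_star x

/-- The separated completion of a ⋆-algebra with respect to a C⋆-seminorm. -/
def Completion : Type u := UniformSpace.Completion p.Space

namespace Completion

instance : NormedRing p.Completion := inferInstanceAs (NormedRing (UniformSpace.Completion p.Space))
instance : Algebra ℂ p.Completion :=
  inferInstanceAs (Algebra ℂ (UniformSpace.Completion p.Space))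
instance : NormedAlgebra ℂ p.Completion where
  norm_smul_le c x :=
    norm_smul_le (α := ℂ) (β := UniformSpace.Completion p.Space) c x
instance : CompleteSpace p.Completion :=
  inferInstanceAs (CompleteSpace (UniformSpace.Completion p.Space))

/-- The canonical map of a ⋆-algebra to its completion, as a map of algebras. -/
def toCompletionAlgHom : R →ₐ[ℂ] p.Completion where
  toFun x := ((show p.Space from x : p.Space) : UniformSpace.Completion p.Space)
  map_one' := UniformSpace.Completion.coe_one _
  map_mul' := UniformSpace.Completion.coe_mul (α := p.Space)
  map_zero' := UniformSpace.Completion.coe_zero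
  map_add' := UniformSpace.Completion.coe_add (α := p.Space)
  commutes' _ := rfl

theorem norm_toCompletionAlgHom (x : R) : ‖toCompletionAlgHom p x‖ = p x :=
  UniformSpace.Completion.norm_coe (E := p.Space) x

theorem denseRange_toCompletionAlgHom : DenseRange (toCompletionAlgHom p) :=
  UniformSpace.Completion.denseRange_coe (α := p.Space)

theorem uniformContinuous_star_space : UniformContinuous (star : p.Space → p.Space) :=
  (AddMonoidHomClass.isometry_of_norm (starAddEquiv : p.Space ≃+ p.Space)
    (norm_star_space p)).uniformContinuous

/-- The involution of the completion: the continuous extension of the given one. -/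
instance : Star p.Completion :=
  ⟨UniformSpace.Completion.map (star : p.Space → p.Space)⟩

theorem continuous_star : Continuous (star : p.Completion → p.Completion) :=
  UniformSpace.Completion.continuous_map

theorem star_toCompletionAlgHom (x : R) :
    star (toCompletionAlgHom p x) = toCompletionAlgHom p (star x) :=
  UniformSpace.Completion.map_coe (uniformContinuous_star_space p) (show p.Space from x)

instance : StarRing p.Completion where
  star_involutive x := by
    refine (denseRange_toCompletionAlgHom p).induction_on x
      (isClosed_eq ((continuous_star p).comp (continuous_star p)) continuous_id) fun a => ?_
    simp [star_toCompletionAlgHom]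
  star_mul x y := by
    refine (denseRange_toCompletionAlgHom p).induction_on₂
      (p := fun x y => star (x * y) = star y * star x)
      (isClosed_eq ((continuous_star p).comp continuous_mul)
        (((continuous_star p).comp continuous_snd).mul
          ((continuous_star p).comp continuous_fst))) (fun a b => ?_) x y
    simp [star_toCompletionAlgHom, ← map_mul]
  star_add x y := by
    refine (denseRange_toCompletionAlgHom p).induction_on₂
      (p := fun x y => star (x + y) = star x + star y)
      (isClosed_eq ((continuous_star p).comp continuous_add)
        (((continuous_star p).comp continuous_fst).add
          ((continuous_star p).comp continuous_snd))) (fun a b => ?_) x y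
    simp [star_toCompletionAlgHom, ← map_add]

variable [StarModule ℂ R]

instance : CStarAlgebra p.Completion where
  norm_mul_self_le x := by
    refine (denseRange_toCompletionAlgHom p).induction_on x
      (isClosed_le (by fun_prop) (((continuous_star p).mul continuous_id).norm)) fun a => ?_
    rw [star_toCompletionAlgHom, ← map_mul, norm_toCompletionAlgHom, norm_toCompletionAlgHom,
      p.star_mul_self, pow_two]
  star_smul c x := by
    refine (denseRange_toCompletionAlgHom p).induction_on x
      (isClosed_eq ((continuous_star p).comp (continuous_const_smul c))
        ((continuous_star p).const_smul (star c))) fun a => ?_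
    rw [← map_smul, star_toCompletionAlgHom, star_toCompletionAlgHom, star_smul, map_smul]

end Completion

/-- The canonical ⋆-homomorphism of a ⋆-algebra to its completion in a C⋆-seminorm. -/
def toCompletion [StarModule ℂ R] : R →⋆ₐ[ℂ] p.Completion where
  toAlgHom := Completion.toCompletionAlgHom p
  map_star' x := (Completion.star_toCompletionAlgHom p x).symm

end Space

end CStarSeminorm

/-! ### Hilbert tensor products and the minimal tensor product -/

section HilbertTensor

variable {H : Type u} [NormedAddCommGroup H] [InnerProductSpace ℂ H]
  {K : Type v} [NormedAddCommGroup K] [InnerProductSpace ℂ K]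

/-- The Hilbert space tensor product `H ⊗ K`: the completion of the algebraic tensor product with
the inner product `⟪a ⊗ b, c ⊗ d⟫ = ⟪a, c⟫ * ⟪b, d⟫`. -/
def HilbertTensor (H : Type u) [NormedAddCommGroup H] [InnerProductSpace ℂ H]
    (K : Type v) [NormedAddCommGroup K] [InnerProductSpace ℂ K] : Type (max u v) :=
  UniformSpace.Completion (H ⊗[ℂ] K)

namespace HilbertTensor

instance : NormedAddCommGroup (HilbertTensor H K) :=
  inferInstanceAs (NormedAddCommGroup (UniformSpace.Completion (H ⊗[ℂ] K)))
instance : InnerProductSpace ℂ (HilbertTensor H K) :=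
  inferInstanceAs (InnerProductSpace ℂ (UniformSpace.Completion (H ⊗[ℂ] K)))
instance : CompleteSpace (HilbertTensor H K) :=
  inferInstanceAs (CompleteSpace (UniformSpace.Completion (H ⊗[ℂ] K)))

/-- The isometric inclusion of the algebraic tensor product. -/
def of : H ⊗[ℂ] K →ₗᵢ[ℂ] HilbertTensor H K :=
  (UniformSpace.Completion.toComplₗᵢ : H ⊗[ℂ] K →ₗᵢ[ℂ] UniformSpace.Completion (H ⊗[ℂ] K))

theorem denseRange_of : DenseRange (of : H ⊗[ℂ] K →ₗᵢ[ℂ] HilbertTensor H K) :=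
  UniformSpace.Completion.denseRange_coe (α := H ⊗[ℂ] K)

end HilbertTensor

/-- The bounded operator `S ⊗ T` on `HilbertTensor H K`, with `(S ⊗ T) (h ⊗ k) = S h ⊗ T k`. -/
def opTensor (S : H →L[ℂ] H) (T : K →L[ℂ] K) : HilbertTensor H K →L[ℂ] HilbertTensor H K :=
  show UniformSpace.Completion (H ⊗[ℂ] K) →L[ℂ] UniformSpace.Completion (H ⊗[ℂ] K) from
    (TensorProduct.mapL S T).completion

theorem opTensor_of (S : H →L[ℂ] H) (T : K →L[ℂ] K) (z : H ⊗[ℂ] K) :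
    opTensor S T (HilbertTensor.of z) = HilbertTensor.of (TensorProduct.mapL S T z) :=
  (TensorProduct.mapL S T).completion_apply_coe z

theorem hilbertTensor_op_ext {S T : HilbertTensor H K →L[ℂ] HilbertTensor H K}
    (h : ∀ z : H ⊗[ℂ] K, S (HilbertTensor.of z) = T (HilbertTensor.of z)) : S = T :=
  ContinuousLinearMap.ext fun x => HilbertTensor.denseRange_of.induction_on x
    (isClosed_eq S.continuous T.continuous) h

theorem opTensor_mul (S S' : H →L[ℂ] H) (T T' : K →L[ℂ] K) :
    opTensor (S * S') (T * T') = opTensor S T * opTensor S' T' := by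
  refine hilbertTensor_op_ext fun z => ?_
  change _ = opTensor S T (opTensor S' T' (HilbertTensor.of z))
  rw [opTensor_of, opTensor_of, opTensor_of, TensorProduct.mapL_mul]
  rfl

theorem opTensor_one : opTensor (1 : H →L[ℂ] H) (1 : K →L[ℂ] K) = 1 := by
  refine hilbertTensor_op_ext fun z => ?_
  rw [opTensor_of]
  exact congrArg _ (congrArg (fun f : H ⊗[ℂ] K →L[ℂ] H ⊗[ℂ] K => f z) TensorProduct.mapL_id_id)

/-- The bilinear map `(S, T) ↦ S ⊗ T`. -/
def opTensorₗ (H : Type u) [NormedAddCommGroup H] [InnerProductSpace ℂ H]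
    (K : Type v) [NormedAddCommGroup K] [InnerProductSpace ℂ K] :
    (H →L[ℂ] H) →ₗ[ℂ] (K →L[ℂ] K) →ₗ[ℂ] (HilbertTensor H K →L[ℂ] HilbertTensor H K) :=
  LinearMap.mk₂ ℂ opTensor
    (fun S S' T => hilbertTensor_op_ext fun z => by
      simp [opTensor_of, TensorProduct.mapL_add_left])
    (fun c S T => hilbertTensor_op_ext fun z => by
      simp [opTensor_of, TensorProduct.mapL_smul_left])
    (fun S T T' => hilbertTensor_op_ext fun z => by
      simp [opTensor_of, TensorProduct.mapL_add_right])
    (fun c S T => hilbertTensor_op_ext fun z => by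
      simp [opTensor_of, TensorProduct.mapL_smul_right])

theorem norm_opTensor_le (S : H →L[ℂ] H) (T : K →L[ℂ] K) : ‖opTensor S T‖ ≤ ‖S‖ * ‖T‖ := by
  refine ContinuousLinearMap.opNorm_le_bound _ (by positivity) fun x => ?_
  refine HilbertTensor.denseRange_of.induction_on x (isClosed_le (by fun_prop) (by fun_prop))
    fun z => ?_
  rw [opTensor_of, LinearIsometry.norm_map, LinearIsometry.norm_map]
  exact (ContinuousLinearMap.le_opNorm _ _).trans
    (mul_le_mul_of_nonneg_right (TensorProduct.norm_mapL_le S T) (norm_nonneg z))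

variable [CompleteSpace H] [CompleteSpace K]

theorem star_opTensor (S : H →L[ℂ] H) (T : K →L[ℂ] K) :
    star (opTensor S T) = opTensor (star S) (star T) := by
  rw [ContinuousLinearMap.star_eq_adjoint, eq_comm, ContinuousLinearMap.eq_adjoint_iff]
  intro x y
  refine HilbertTensor.denseRange_of.induction_on₂
    (p := fun x y => inner ℂ (opTensor (star S) (star T) x) y = inner ℂ x (opTensor S T y))
    (isClosed_eq (by fun_prop) (by fun_prop)) (fun a b => ?_) x y
  rw [opTensor_of, opTensor_of, LinearIsometry.inner_map_map, LinearIsometry.inner_map_map]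
  induction a using TensorProduct.induction_on with
  | zero => simp
  | add a a' h h' => simp only [map_add, inner_add_left, h, h']
  | tmul h k =>
    induction b using TensorProduct.induction_on with
    | zero => simp
    | add b b' h h' => simp only [map_add, inner_add_right, h, h']
    | tmul h' k' =>
      simp [ContinuousLinearMap.star_eq_adjoint, ContinuousLinearMap.adjoint_inner_left]

variable {A : Type u} [CStarAlgebra A] {B : Type v} [CStarAlgebra B]

/-- The ⋆-representation `π ⊗ ρ` of the algebraic tensor product `A ⊗ B` on `HilbertTensor H K`,
with `(π ⊗ ρ) (a ⊗ b) = π a ⊗ ρ b`. -/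
def tensorRep (π : A →⋆ₐ[ℂ] (H →L[ℂ] H)) (ρ : B →⋆ₐ[ℂ] (K →L[ℂ] K)) :
    A ⊗[ℂ] B →⋆ₐ[ℂ] (HilbertTensor H K →L[ℂ] HilbertTensor H K) where
  toAlgHom := Algebra.TensorProduct.algHomOfLinearMapTensorProduct
    (TensorProduct.lift
      ((opTensorₗ H K).compl₁₂ π.toAlgHom.toLinearMap ρ.toAlgHom.toLinearMap))
    (fun a a' b b' => by
      change opTensor (π (a * a')) (ρ (b * b')) = opTensor (π a) (ρ b) * opTensor (π a') (ρ b')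
      rw [map_mul, map_mul, opTensor_mul])
    (by
      change opTensor (π 1) (ρ 1) = 1
      rw [map_one, map_one, opTensor_one])
  map_star' x := by
    induction x using TensorProduct.induction_on with
    | zero => simp
    | add x y hx hy =>
      simp only [AlgHom.toRingHom_eq_coe, RingHom.toMonoidHom_eq_coe, OneHom.toFun_eq_coe,
        MonoidHom.toOneHom_coe, MonoidHom.coe_coe, RingHom.coe_coe, star_add, map_add] at hx hy ⊢
      rw [hx, hy]
    | tmul a b =>
      change opTensor (π (star a)) (ρ (star b)) = star (opTensor (π a) (ρ b))
      rw [star_opTensor, map_star, map_star]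

theorem tensorRep_tmul (π : A →⋆ₐ[ℂ] (H →L[ℂ] H)) (ρ : B →⋆ₐ[ℂ] (K →L[ℂ] K)) (a : A) (b : B) :
    tensorRep π ρ (a ⊗ₜ[ℂ] b) = opTensor (π a) (ρ b) := rfl

end HilbertTensor

section MinTensor

variable (A : Type u) [CStarAlgebra A] (B : Type v) [CStarAlgebra B]

/-- The C⋆-seminorms `x ↦ ‖(π ⊗ ρ) x‖` on the algebraic tensor product `A ⊗ B`, where `π` and `ρ`
run over all the ⋆-representations of `A` and `B` on Hilbert spaces. -/
def spatialSeminorms : Set (CStarSeminorm (A ⊗[ℂ] B)) :=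
  {p | ∃ (H : Type u) (_ : NormedAddCommGroup H) (_ : InnerProductSpace ℂ H) (_ : CompleteSpace H)
      (K : Type v) (_ : NormedAddCommGroup K) (_ : InnerProductSpace ℂ K) (_ : CompleteSpace K)
      (π : A →⋆ₐ[ℂ] (H →L[ℂ] H)) (ρ : B →⋆ₐ[ℂ] (K →L[ℂ] K)),
      p = CStarSeminorm.ofStarAlgHom (tensorRep π ρ)}

theorem bddAbove_spatialSeminorms (x : A ⊗[ℂ] B) :
    BddAbove ((fun p : CStarSeminorm (A ⊗[ℂ] B) => p x) '' spatialSeminorms A B) := by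
  suffices h : ∃ c : ℝ, ∀ p ∈ spatialSeminorms A B, p x ≤ c by
    obtain ⟨c, hc⟩ := h
    exact ⟨c, by rintro _ ⟨p, hp, rfl⟩; exact hc p hp⟩
  induction x using TensorProduct.induction_on with
  | zero => exact ⟨0, fun p _ => (map_zero p.toSeminorm).le⟩
  | add x y hx hy =>
    obtain ⟨c, hc⟩ := hx
    obtain ⟨d, hd⟩ := hy
    exact ⟨c + d, fun p hp =>
      (map_add_le_add p.toSeminorm x y).trans (add_le_add (hc p hp) (hd p hp))⟩
  | tmul a b =>
    refine ⟨‖a‖ * ‖b‖, ?_⟩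
    rintro _ ⟨H, _, _, _, K, _, _, _, π, ρ, rfl⟩
    rw [CStarSeminorm.ofStarAlgHom_apply, tensorRep_tmul]
    exact (norm_opTensor_le _ _).trans (mul_le_mul (NonUnitalStarAlgHom.norm_apply_le π a)
      (NonUnitalStarAlgHom.norm_apply_le ρ b) (norm_nonneg _) (norm_nonneg _))

/-- The minimal (spatial) C⋆-norm on the algebraic tensor product `A ⊗ B`:
`‖x‖_min = sup ‖(π ⊗ ρ) x‖`, over all the ⋆-representations `π` of `A` and `ρ` of `B`. -/
def minCStarNorm : CStarSeminorm (A ⊗[ℂ] B) :=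
  CStarSeminorm.sSupOf (spatialSeminorms A B) (bddAbove_spatialSeminorms A B)

/-- The minimal tensor product of unital C⋆-algebras: the completion of the algebraic tensor
product in the minimal C⋆-norm. -/
abbrev MinTensor : Type (max u v) := (minCStarNorm A B).Completion

instance : PartialOrder (MinTensor A B) := CStarAlgebra.spectralOrder _
instance : StarOrderedRing (MinTensor A B) := CStarAlgebra.spectralOrderedRing _

variable {A B}

/-- The elementary tensor `a ⊗ b` in the minimal tensor product. -/
def MinTensor.tmul (a : A) (b : B) : MinTensor A B := (minCStarNorm A B).toCompletion (a ⊗ₜ[ℂ] b)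

end MinTensor

/-! ### Measurements -/

section Measurements

variable {A : Type u} [CStarAlgebra A] {k m : ℕ}

/-- A family `P a x` of elements of a unital C⋆-algebra (with `k` outcomes `a` and `m` settings `x`)
consists of PVM elements: every `P a x` is a self-adjoint projection, and `∑ a, P a x = 1` for
every `x`. -/
def IsPVMFamily (P : Fin k → Fin m → A) : Prop :=
  (∀ a x, IsStarProjection (P a x)) ∧ ∀ x, ∑ a, P a x = 1

/-- A family `M a x` of elements of a unital C⋆-algebra consists of POVM elements: every `M a x` is
positive, and `∑ a, M a x = 1` for every `x`. -/
def IsPOVMFamily [PartialOrder A] (M : Fin k → Fin m → A) : Prop :=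
  (∀ a x, 0 ≤ M a x) ∧ ∀ x, ∑ a, M a x = 1

end Measurements

/-! ### The universal C⋆-algebra of `m` projective measurements with `k` outcomes -/

/-- The free complex unital ⋆-algebra on a set `X` of self-adjoint generators: linear combinations
of words in `X`. -/
abbrev FreeStarAlgebra (X : Type u) : Type u := MonoidAlgebra ℂ (FreeMonoid X)

namespace FreeStarAlgebra

variable {X : Type u}

/-- The involution: it conjugates the coefficients and reverses the words. -/
instance : Star (FreeStarAlgebra X) :=
  ⟨fun f => (f.mapDomain star).map (starAddEquiv (R := ℂ)).toAddMonoidHom⟩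

theorem star_single (w : FreeMonoid X) (c : ℂ) :
    star (MonoidAlgebra.single w c : FreeStarAlgebra X) =
      MonoidAlgebra.single (star w) (star c) := by
  change MonoidAlgebra.map _ (MonoidAlgebra.mapDomain star (MonoidAlgebra.single w c)) = _
  simp

theorem star_add' (f g : FreeStarAlgebra X) : star (f + g) = star f + star g := by
  change MonoidAlgebra.map _ (MonoidAlgebra.mapDomain star (f + g)) = _
  rw [MonoidAlgebra.mapDomain_add, MonoidAlgebra.map_add]
  rfl

theorem star_zero' : star (0 : FreeStarAlgebra X) = 0 := by
  change MonoidAlgebra.map _ (MonoidAlgebra.mapDomain star 0) = _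
  simp

instance : StarRing (FreeStarAlgebra X) where
  star_involutive f := by
    induction f using MonoidAlgebra.induction_linear with
    | zero => simp [star_zero']
    | add f g hf hg => rw [star_add', star_add', hf, hg]
    | single w c => simp [star_single]
  star_mul f g := by
    induction f using MonoidAlgebra.induction_linear with
    | zero => simp [star_zero']
    | add f f' hf hf' => rw [add_mul, star_add', hf, hf', star_add', mul_add]
    | single w c =>
      induction g using MonoidAlgebra.induction_linear with
      | zero => simp [star_zero']
      | add g g' hg hg' => rw [mul_add, star_add', hg, hg', star_add', add_mul]
      | single w' c' => simp [star_single, mul_comm]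
  star_add := star_add'

instance : StarModule ℂ (FreeStarAlgebra X) where
  star_smul c f := by
    induction f using MonoidAlgebra.induction_linear with
    | zero => simp
    | add f g hf hg => rw [smul_add, star_add, hf, hg, star_add, smul_add]
    | single w d => simp [star_single]

/-- The generators. -/
def gen (x : X) : FreeStarAlgebra X := MonoidAlgebra.single (FreeMonoid.of x) 1

theorem star_gen (x : X) : star (gen x) = gen x := by
  simp [gen, star_single]

end FreeStarAlgebra

section PVMAlgebra

variable (m k : ℕ)

/-- The relations `P a x * P a x = P a x` and `∑ a, P a x = 1` between the self-adjoint generators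
`P a x`, written as elements which have to vanish. -/
def pvmRelations : Set (FreeStarAlgebra (Fin k × Fin m)) :=
  {r | ∃ a x, r = FreeStarAlgebra.gen (a, x) * FreeStarAlgebra.gen (a, x) -
      FreeStarAlgebra.gen (a, x)} ∪
    {r | ∃ x : Fin m, r = ∑ a : Fin k, FreeStarAlgebra.gen (a, x) - 1}

/-- The C⋆-seminorms on the free ⋆-algebra which respect the relations. -/
def pvmSeminorms : Set (CStarSeminorm (FreeStarAlgebra (Fin k × Fin m))) :=
  {p | ∀ r ∈ pvmRelations m k, p r = 0}

variable {m k}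

theorem pvmSeminorms_gen_le {p : CStarSeminorm (FreeStarAlgebra (Fin k × Fin m))}
    (hp : p ∈ pvmSeminorms m k) (i : Fin k × Fin m) : p (FreeStarAlgebra.gen i) ≤ 1 := by
  set g : FreeStarAlgebra (Fin k × Fin m) := FreeStarAlgebra.gen i with hg
  have h0 : p (g * g - g) = 0 := hp _ (Or.inl ⟨i.1, i.2, rfl⟩)
  have h1 : p (g * g) = p g ^ 2 := by
    rw [← p.star_mul_self, hg, FreeStarAlgebra.star_gen]
  have h2 : p (g * g) ≤ p (g * g - g) + p g := by
    simpa using map_add_le_add p.toSeminorm (g * g - g) g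
  nlinarith [p.nonneg g]

theorem pvmSeminorms_word_le {p : CStarSeminorm (FreeStarAlgebra (Fin k × Fin m))}
    (hp : p ∈ pvmSeminorms m k) (w : FreeMonoid (Fin k × Fin m)) :
    p (MonoidAlgebra.single w 1) ≤ 1 := by
  induction w using FreeMonoid.inductionOn' with
  | one => exact p.map_one_le
  | of_mul i w hw =>
    have h : (MonoidAlgebra.single (FreeMonoid.of i * w) 1 : FreeStarAlgebra (Fin k × Fin m)) =
        FreeStarAlgebra.gen i * MonoidAlgebra.single w 1 := by
      simp [FreeStarAlgebra.gen]
    rw [h]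
    exact (p.mul_le _ _).trans
      (mul_le_one₀ (pvmSeminorms_gen_le hp i) (p.nonneg _) hw)

variable (m k)

theorem bddAbove_pvmSeminorms (f : FreeStarAlgebra (Fin k × Fin m)) :
    BddAbove ((fun p : CStarSeminorm (FreeStarAlgebra (Fin k × Fin m)) => p f) ''
      pvmSeminorms m k) := by
  suffices h : ∃ c : ℝ, ∀ p ∈ pvmSeminorms m k, p f ≤ c by
    obtain ⟨c, hc⟩ := h
    exact ⟨c, by rintro _ ⟨p, hp, rfl⟩; exact hc p hp⟩
  induction f using MonoidAlgebra.induction_linear with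
  | zero => exact ⟨0, fun p _ => (map_zero p.toSeminorm).le⟩
  | add x y hx hy =>
    obtain ⟨c, hc⟩ := hx
    obtain ⟨d, hd⟩ := hy
    exact ⟨c + d, fun p hp =>
      (map_add_le_add p.toSeminorm x y).trans (add_le_add (hc p hp) (hd p hp))⟩
  | single w c =>
    refine ⟨‖c‖, fun p hp => ?_⟩
    have h : (MonoidAlgebra.single w c : FreeStarAlgebra (Fin k × Fin m)) =
        c • MonoidAlgebra.single w 1 := by simp
    rw [h, map_smul_eq_mul]
    exact mul_le_of_le_one_right (norm_nonneg c) (pvmSeminorms_word_le hp w)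

/-- The largest C⋆-seminorm on the free ⋆-algebra which respects the relations. -/
def pvmUniversalSeminorm : CStarSeminorm (FreeStarAlgebra (Fin k × Fin m)) :=
  CStarSeminorm.sSupOf (pvmSeminorms m k) (bddAbove_pvmSeminorms m k)

/-- The universal unital C⋆-algebra `C⋆(m, k)` generated by projections `P a x`, for `k` outcomes
`a` and `m` settings `x`, with `∑ a, P a x = 1` for every `x`. -/
abbrev PVMAlgebra : Type := (pvmUniversalSeminorm m k).Completion

variable {m k}

/-- The generating projections of `C⋆(m, k)`. -/
def PVMAlgebra.proj (a : Fin k) (x : Fin m) : PVMAlgebra m k :=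
  (pvmUniversalSeminorm m k).toCompletion (FreeStarAlgebra.gen (a, x))

theorem PVMAlgebra.isPVMFamily_proj : IsPVMFamily (PVMAlgebra.proj (m := m) (k := k)) := by
  have key : ∀ r ∈ pvmRelations m k, (pvmUniversalSeminorm m k).toCompletion r = 0 := by
    intro r hr
    rw [← norm_eq_zero]
    refine (CStarSeminorm.Completion.norm_toCompletionAlgHom _ r).trans ?_
    refine le_antisymm (Real.sSup_le ?_ le_rfl) (CStarSeminorm.nonneg _ _)
    rintro _ ⟨p, hp, rfl⟩
    exact (hp r hr).le
  refine ⟨fun a x => ⟨?_, ?_⟩, fun x => ?_⟩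
  · have := key _ (Or.inl ⟨a, x, rfl⟩)
    rwa [map_sub, map_mul, sub_eq_zero] at this
  · change star _ = _
    rw [PVMAlgebra.proj, ← map_star, FreeStarAlgebra.star_gen]
  · have := key _ (Or.inr ⟨x, rfl⟩)
    rwa [map_sub, map_sum, map_one, sub_eq_zero] at this

end PVMAlgebra

end

-- The substantial implications both pull a state back along `T ⊗ id` for a linear map `T : D → A`.
-- From (2) to (1), `T` is the ⋆-homomorphism from `C⋆(m, k)` to `A` given by the universal
-- property. From (3) to (2), `T` is the compression of a matrix algebra over `A` to one diagonal
-- entry, and the POVM elements are dilated to projections having them as that entry. (2) to (3)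
-- holds since projections are positive, and (1) to (2) needs only a change of universe.
--
-- `MinTensor.exists_pullback` treats both maps at once. Two facts about `T` suffice. If every
-- representation of `A` is a compression along `T` of a representation of `D`, then matrix
-- coefficients of `(T ⊗ id) z` are coefficients of `z`, so `T ⊗ id` is contractive for the minimal
-- norms (`minCStarNorm_rTensor_le`). If `T (d* d')` has the form `∑ i, (S i d)* (S i d')`, then `T
-- ⊗ id` sends squares to sums of squares, and positivity survives.
--
-- The dilation (`Matrix.exists_pvm_dilation`) is Naimark's theorem in finite matrices: the column
-- of square roots of `M a` is an isometry, it is completed to a unitary `U`, and the projections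
-- are `U* E_a U` with `E_a` diagonal.
--
-- The minimal norm is a supremum over Hilbert spaces in the universes of the algebras, whereas the
-- dilated representations of `D` live in the universe of `A`. `norm_tensorOp_le` removes the
-- restriction for the left factor: a matrix coefficient at algebraic tensors sees only a finitely
-- generated subrepresentation, which is small.

universe w

noncomputable section

/-! ### Compressions of tensor product representations -/

section Compression

variable {A : Type u} [CStarAlgebra A] {B : Type v} [CStarAlgebra B]

/-- The operators `(π ⊗ ρ) z`, for Hilbert spaces in arbitrary universes. -/
def tensorOp {A : Type*} [CStarAlgebra A] {B : Type*} [CStarAlgebra B]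
    {H : Type*} [NormedAddCommGroup H] [InnerProductSpace ℂ H] [CompleteSpace H]
    {K : Type*} [NormedAddCommGroup K] [InnerProductSpace ℂ K] [CompleteSpace K]
    (π : A →⋆ₐ[ℂ] (H →L[ℂ] H)) (ρ : B →⋆ₐ[ℂ] (K →L[ℂ] K)) :
    A ⊗[ℂ] B →ₗ[ℂ] (HilbertTensor H K →L[ℂ] HilbertTensor H K) :=
  TensorProduct.lift ((opTensorₗ H K).compl₁₂ π.toAlgHom.toLinearMap ρ.toAlgHom.toLinearMap)

theorem tensorOp_tmul {A : Type*} [CStarAlgebra A] {B : Type*} [CStarAlgebra B]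
    {H : Type*} [NormedAddCommGroup H] [InnerProductSpace ℂ H] [CompleteSpace H]
    {K : Type*} [NormedAddCommGroup K] [InnerProductSpace ℂ K] [CompleteSpace K]
    (π : A →⋆ₐ[ℂ] (H →L[ℂ] H)) (ρ : B →⋆ₐ[ℂ] (K →L[ℂ] K)) (a : A) (b : B) :
    tensorOp π ρ (a ⊗ₜ[ℂ] b) = opTensor (π a) (ρ b) := rfl

/-- If `T` is a compression of `π'` to `π`, then `T ⊗ id` is a compression of `π' ⊗ ρ` to
`π ⊗ ρ`. -/
theorem inner_tensorOp_of_compression {D : Type*} [CStarAlgebra D]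
    {H : Type*} [NormedAddCommGroup H] [InnerProductSpace ℂ H] [CompleteSpace H]
    {H' : Type*} [NormedAddCommGroup H'] [InnerProductSpace ℂ H'] [CompleteSpace H']
    {K : Type*} [NormedAddCommGroup K] [InnerProductSpace ℂ K] [CompleteSpace K]
    (π : A →⋆ₐ[ℂ] (H →L[ℂ] H)) (π' : D →⋆ₐ[ℂ] (H' →L[ℂ] H')) (ρ : B →⋆ₐ[ℂ] (K →L[ℂ] K))
    (T : D →ₗ[ℂ] A) (W₁ W₂ : H →ₗᵢ[ℂ] H')
    (h : ∀ d x y, inner ℂ (W₁ x) (π' d (W₂ y)) = inner ℂ x (π (T d) y))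
    (z : D ⊗[ℂ] B) (ξ η : H ⊗[ℂ] K) :
    inner ℂ (HilbertTensor.of (TensorProduct.mapIsometry W₁ .id ξ))
      (tensorOp π' ρ z (HilbertTensor.of (TensorProduct.mapIsometry W₂ .id η))) =
    inner ℂ (HilbertTensor.of ξ) (tensorOp π ρ (T.rTensor B z) (HilbertTensor.of η)) := by
  induction z using TensorProduct.induction_on with
  | zero => simp
  | add z z' hz hz' => simp only [map_add, add_apply, inner_add_right, hz, hz']
  | tmul d b =>
    rw [LinearMap.rTensor_tmul, tensorOp_tmul, tensorOp_tmul, opTensor_of, opTensor_of,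
      LinearIsometry.inner_map_map, LinearIsometry.inner_map_map]
    induction ξ using TensorProduct.induction_on with
    | zero => simp
    | add ξ ξ' hξ hξ' => simp only [map_add, inner_add_left, hξ, hξ']
    | tmul x k =>
      induction η using TensorProduct.induction_on with
      | zero => simp
      | add η η' hη hη' => simp only [map_add, inner_add_right, hη, hη']
      | tmul y l => simp [h]

/-- By density the bound passes to all vectors, and then `x = S y` gives the norm. It allows testing
on algebraic tensors, which involve only finitely many vectors of each factor. -/
theorem norm_le_of_inner_hilbertTensor_le
    {H : Type*} [NormedAddCommGroup H] [InnerProductSpace ℂ H]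
    {K : Type*} [NormedAddCommGroup K] [InnerProductSpace ℂ K]
    (S : HilbertTensor H K →L[ℂ] HilbertTensor H K) {c : ℝ} (hc : 0 ≤ c)
    (h : ∀ ξ η : H ⊗[ℂ] K, ‖inner ℂ (HilbertTensor.of ξ) (S (HilbertTensor.of η))‖ ≤
      c * ‖ξ‖ * ‖η‖) : ‖S‖ ≤ c := by
  have key : ∀ x y, ‖inner ℂ x (S y)‖ ≤ c * ‖x‖ * ‖y‖ := fun x y => by
    refine HilbertTensor.denseRange_of.induction_on₂
      (p := fun x y => ‖inner ℂ x (S y)‖ ≤ c * ‖x‖ * ‖y‖)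
      (isClosed_le (by fun_prop) (by fun_prop)) (fun a b => ?_) x y
    simpa using h a b
  refine S.opNorm_le_bound hc fun y => ?_
  rcases (norm_nonneg (S y)).eq_or_lt with h0 | h0
  · rw [← h0]; positivity
  · have := key (S y) y
    rw [inner_self_eq_norm_sq_to_K] at this
    norm_cast at this
    rw [abs_of_nonneg (by positivity)] at this
    nlinarith

theorem norm_inner_hilbertTensor_le
    {H : Type*} [NormedAddCommGroup H] [InnerProductSpace ℂ H]
    {K : Type*} [NormedAddCommGroup K] [InnerProductSpace ℂ K]
    {S : HilbertTensor H K →L[ℂ] HilbertTensor H K} {c : ℝ} (h : ‖S‖ ≤ c) (ξ η : H ⊗[ℂ] K) :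
    ‖inner ℂ (HilbertTensor.of ξ) (S (HilbertTensor.of η))‖ ≤ c * ‖ξ‖ * ‖η‖ :=
  calc _ ≤ ‖HilbertTensor.of ξ‖ * ‖S (HilbertTensor.of η)‖ := norm_inner_le_norm _ _
    _ ≤ ‖HilbertTensor.of ξ‖ * (c * ‖HilbertTensor.of η‖) := by gcongr; exact S.le_of_opNorm_le h _
    _ = _ := by rw [LinearIsometry.norm_map, LinearIsometry.norm_map]; ring

/-- Here `H` and `K` lie in the universes of `A` and `B`, so the representation is one of those in
the supremum. -/
theorem norm_tensorOp_le_of_small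
    {H : Type u} [NormedAddCommGroup H] [InnerProductSpace ℂ H] [CompleteSpace H]
    {K : Type v} [NormedAddCommGroup K] [InnerProductSpace ℂ K] [CompleteSpace K]
    (π : A →⋆ₐ[ℂ] (H →L[ℂ] H)) (ρ : B →⋆ₐ[ℂ] (K →L[ℂ] K)) (z : A ⊗[ℂ] B) :
    ‖tensorOp π ρ z‖ ≤ minCStarNorm A B z :=
  le_csSup (bddAbove_spatialSeminorms A B z)
    ⟨_, ⟨H, _, _, _, K, _, _, _, π, ρ, rfl⟩, rfl⟩

end Compression

/-! ### Moving representations to the universe of the algebra -/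

section Small

/-- A representation restricts to the range of an isometry which it leaves invariant. -/
theorem exists_restrict_of_invariant {A : Type*} [CStarAlgebra A]
    {H : Type*} [NormedAddCommGroup H] [InnerProductSpace ℂ H] [CompleteSpace H]
    {H₀ : Type*} [NormedAddCommGroup H₀] [InnerProductSpace ℂ H₀] [CompleteSpace H₀]
    (π : A →⋆ₐ[ℂ] (H →L[ℂ] H)) (V : H₀ →ₗᵢ[ℂ] H) (hV : ∀ a x, ∃ y, V y = π a (V x)) :
    ∃ π₀ : A →⋆ₐ[ℂ] (H₀ →L[ℂ] H₀), ∀ a x, V (π₀ a x) = π a (V x) := by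
  let W : H₀ →L[ℂ] H := V.toContinuousLinearMap
  have hadj : ∀ x, W.adjoint (V x) = x := fun x => ext_inner_left ℂ fun y => by
    rw [ContinuousLinearMap.adjoint_inner_right]
    exact V.inner_map_map y x
  -- `W W*` acts as the identity on the range of `V`, where `π a (V x)` lies by invariance; this
  -- makes `a ↦ W* π(a) W` multiplicative.
  have key : ∀ a x, V (W.adjoint (π a (V x))) = π a (V x) := fun a x => by
    obtain ⟨y, hy⟩ := hV a x
    rw [← hy, hadj]
  refine ⟨{ toFun := fun a => W.adjoint ∘L π a ∘L W
            map_one' := ?_, map_mul' := ?_, map_zero' := ?_, map_add' := ?_, commutes' := ?_,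
            map_star' := ?_ }, fun a x => key a x⟩
  · ext x; rw [map_one]; exact hadj x
  · intro a b
    ext x
    change W.adjoint (π (a * b) (V x)) = W.adjoint (π a (V (W.adjoint (π b (V x)))))
    rw [key, map_mul]; rfl
  · ext x; simp
  · intro a b; ext x; simp
  · intro r
    ext x
    have := congrArg (r • ·) (hadj x)
    simpa [Algebra.algebraMap_eq_smul_one, W] using! this
  · intro a
    simp [ContinuousLinearMap.star_eq_adjoint, ContinuousLinearMap.adjoint_comp, map_star,
      ContinuousLinearMap.comp_assoc]

-- A point of the closure is the limit of a sequence from the range and is determined by it, so the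
-- closure injects into `ℕ → X`.
open Filter Topology in
theorem small_closure_range {X : Type u} {Y : Type w} [TopologicalSpace Y] [T2Space Y]
    [FirstCountableTopology Y] (f : X → Y) : Small.{u} (closure (Set.range f)) := by
  have h : ∀ y : closure (Set.range f), ∃ s : ℕ → X, Tendsto (f ∘ s) atTop (𝓝 y.1) := fun y => by
    obtain ⟨t, ht, hty⟩ := mem_closure_iff_seq_limit.mp y.2
    choose s hs using ht
    exact ⟨s, by simpa [Function.comp_def, hs] using hty⟩
  choose s hs using h
  exact small_of_injective (f := s) fun y y' hyy => Subtype.ext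
    (tendsto_nhds_unique (hs y) (hyy ▸ hs y'))

/-- A small Hilbert space is isometric to one in the smaller universe. -/
theorem exists_linearIsometryEquiv_of_small (S : Type w) [NormedAddCommGroup S]
    [InnerProductSpace ℂ S] [CompleteSpace S] [Small.{u} S] :
    ∃ (H : Type u) (_ : NormedAddCommGroup H) (_ : InnerProductSpace ℂ H) (_ : CompleteSpace H),
      Nonempty (H ≃ₗᵢ[ℂ] S) := by
  obtain ⟨b, e, -⟩ := exists_hilbertBasis ℂ S
  -- Reindexing a Hilbert basis by its shrunken index set identifies `S` with an `ℓ²` space in the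
  -- smaller universe.
  have he := e.orthonormal.comp (equivShrink.{u} b).symm (equivShrink.{u} b).symm.injective
  have e' : HilbertBasis (Shrink.{u} b) ℂ S := HilbertBasis.mk he (by
    rw [EquivLike.range_comp]
    exact e.dense_span.ge)
  exact ⟨_, _, _, inferInstance, ⟨e'.repr.symm⟩⟩

/-- Finitely many vectors of a representation of `A` lie in a subrepresentation in the universe
of `A`. -/
theorem exists_subrep_of_fg {A : Type u} [CStarAlgebra A]
    {H : Type w} [NormedAddCommGroup H] [InnerProductSpace ℂ H] [CompleteSpace H]
    (π : A →⋆ₐ[ℂ] (H →L[ℂ] H)) (M : Submodule ℂ H) (hM : M.FG) :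
    ∃ (H₀ : Type u) (_ : NormedAddCommGroup H₀) (_ : InnerProductSpace ℂ H₀)
      (_ : CompleteSpace H₀) (π₀ : A →⋆ₐ[ℂ] (H₀ →L[ℂ] H₀)) (V : H₀ →ₗᵢ[ℂ] H),
      (∀ a x, V (π₀ a x) = π a (V x)) ∧ M ≤ LinearMap.range V.toLinearMap := by
  obtain ⟨n, s, rfl⟩ := Submodule.fg_iff_exists_fin_generating_family.mp hM
  -- The range of `L` is the `A`-submodule generated by the vectors `s i`. Its closure is invariant,
  -- and small because `Fin n → A` lies in the universe of `A`.
  let L : (Fin n → A) →ₗ[ℂ] H :=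
    { toFun := fun a => ∑ i, π (a i) (s i)
      map_add' := fun a b => by simp [Finset.sum_add_distrib]
      map_smul' := fun c a => by simp [Finset.smul_sum] }
  let S := (LinearMap.range L).topologicalClosure
  have : CompleteSpace S := (LinearMap.range L).isClosed_topologicalClosure.completeSpace_coe
  have : Small.{u} S := small_closure_range.{u, w} L
  obtain ⟨H₀, _, _, _, ⟨e⟩⟩ := exists_linearIsometryEquiv_of_small.{u, w} S
  let V : H₀ →ₗᵢ[ℂ] H := S.subtypeₗᵢ.comp e.toLinearIsometry
  have hmem : ∀ x ∈ S, ∃ y, V y = x := fun x hx => ⟨e.symm ⟨x, hx⟩, by simp [V]⟩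
  have hinv : ∀ a, ∀ x ∈ S, π a x ∈ S := fun a x hx => by
    refine map_mem_closure (π a).continuous hx ?_
    rintro _ ⟨c, rfl⟩
    exact ⟨fun i => a * c i, by simp [L]⟩
  obtain ⟨π₀, hπ₀⟩ := exists_restrict_of_invariant π V fun a x => hmem _ (hinv a _ (by simp [V]))
  refine ⟨H₀, _, _, _, π₀, V, hπ₀, Submodule.span_le.mpr ?_⟩
  rintro _ ⟨i, rfl⟩
  obtain ⟨y, hy⟩ := hmem (s i) ((LinearMap.range L).le_topologicalClosure
    ⟨Pi.single i 1, by
      change ∑ j, π (Pi.single (M := fun _ => A) i 1 j) (s j) = _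
      rw [Finset.sum_eq_single i]
      · simp
      · intro j _ hj; simp [hj]
      · simp⟩)
  exact ⟨y, hy⟩

end Small

/-! ### Contractivity for the minimal norm -/

/-- Each coefficient at algebraic tensors is computed in a subrepresentation on a space in the
universe of `A`, where the bound holds by definition of the supremum. -/
theorem norm_tensorOp_le {A : Type u} [CStarAlgebra A] {B : Type v} [CStarAlgebra B]
    {H : Type w} [NormedAddCommGroup H] [InnerProductSpace ℂ H] [CompleteSpace H]
    {K : Type v} [NormedAddCommGroup K] [InnerProductSpace ℂ K] [CompleteSpace K]
    (π : A →⋆ₐ[ℂ] (H →L[ℂ] H)) (ρ : B →⋆ₐ[ℂ] (K →L[ℂ] K)) (z : A ⊗[ℂ] B) :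
    ‖tensorOp π ρ z‖ ≤ minCStarNorm A B z := by
  refine norm_le_of_inner_hilbertTensor_le _ (CStarSeminorm.nonneg _ z) fun ξ η => ?_
  obtain ⟨M, hM, hs⟩ := TensorProduct.exists_finite_submodule_left_of_setFinite {ξ, η}
    (Set.toFinite _)
  obtain ⟨H₀, _, _, _, π₀, V, hV, hMV⟩ := exists_subrep_of_fg π M (Module.Finite.iff_fg.mp hM)
  have hrange : ∀ ζ ∈ ({ξ, η} : Set (H ⊗[ℂ] K)),
      ∃ ζ₀ : H₀ ⊗[ℂ] K, TensorProduct.mapIsometry V .id ζ₀ = ζ := fun ζ hζ => by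
    obtain ⟨t, rfl⟩ := hs hζ
    clear hs hζ
    induction t using TensorProduct.induction_on with
    | zero => exact ⟨0, by simp⟩
    | add t t' ht ht' =>
      obtain ⟨x, hx⟩ := ht
      obtain ⟨x', hx'⟩ := ht'
      exact ⟨x + x', by rw [map_add, map_add, hx, hx']⟩
    | tmul y k =>
      obtain ⟨x, hx⟩ := hMV y.2
      exact ⟨x ⊗ₜ k, by simpa using congrArg (· ⊗ₜ[ℂ] k) hx⟩
  obtain ⟨ξ₀, rfl⟩ := hrange ξ (by simp)
  obtain ⟨η₀, rfl⟩ := hrange η (by simp)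
  -- A subrepresentation is a compression along the identity map of `A`.
  have h := inner_tensorOp_of_compression π₀ π ρ LinearMap.id V V
    (fun d x y => by rw [← hV, V.inner_map_map]; rfl) z ξ₀ η₀
  rw [h, LinearMap.rTensor_id, LinearMap.id_apply, LinearIsometry.norm_map,
    LinearIsometry.norm_map]
  exact norm_inner_hilbertTensor_le (norm_tensorOp_le_of_small π₀ ρ z) ξ₀ η₀

/-- The coefficients of `(π ⊗ ρ) ((T ⊗ id) z)` are those of `(π' ⊗ ρ) z` at vectors moved by the
isometries `W₁ ⊗ id` and `W₂ ⊗ id`. Hypothesis `hT` plays the part of a Stinespring dilation of `π ∘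
T`. -/
theorem minCStarNorm_rTensor_le {D : Type w} [CStarAlgebra D] {A : Type u} [CStarAlgebra A]
    {B : Type v} [CStarAlgebra B] (T : D →ₗ[ℂ] A)
    (hT : ∀ (H : Type u) [NormedAddCommGroup H] [InnerProductSpace ℂ H] [CompleteSpace H]
      (π : A →⋆ₐ[ℂ] (H →L[ℂ] H)), ∃ (H' : Type u) (_ : NormedAddCommGroup H')
      (_ : InnerProductSpace ℂ H') (_ : CompleteSpace H') (π' : D →⋆ₐ[ℂ] (H' →L[ℂ] H'))
      (W₁ W₂ : H →ₗᵢ[ℂ] H'), ∀ d x y, inner ℂ (W₁ x) (π' d (W₂ y)) = inner ℂ x (π (T d) y))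
    (z : D ⊗[ℂ] B) : minCStarNorm A B (T.rTensor B z) ≤ minCStarNorm D B z := by
  refine Real.sSup_le ?_ (CStarSeminorm.nonneg _ z)
  rintro _ ⟨_, ⟨H, _, _, _, K, _, _, _, π, ρ, rfl⟩, rfl⟩
  obtain ⟨H', _, _, _, π', W₁, W₂, h⟩ := hT H π
  change ‖tensorOp π ρ (T.rTensor B z)‖ ≤ _
  refine norm_le_of_inner_hilbertTensor_le _ (CStarSeminorm.nonneg _ z) fun ξ η => ?_
  rw [← inner_tensorOp_of_compression π π' ρ T W₁ W₂ h]
  exact (norm_inner_hilbertTensor_le (norm_tensorOp_le π' ρ z) _ _).trans_eq (by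
    rw [LinearIsometry.norm_map, LinearIsometry.norm_map])

/-! ### Extending maps to the completion -/

section Extension

variable {R : Type*} [Ring R] [StarRing R] [Algebra ℂ R] [StarModule ℂ R]

namespace CStarSeminorm

theorem denseRange_toCompletion (p : CStarSeminorm R) : DenseRange p.toCompletion :=
  Completion.denseRange_toCompletionAlgHom p

theorem norm_toCompletion (p : CStarSeminorm R) (x : R) : ‖p.toCompletion x‖ = p x :=
  Completion.norm_toCompletionAlgHom p x

theorem exists_extend (p : CStarSeminorm R) {E : Type*} [NormedAddCommGroup E] [NormedSpace ℂ E]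
    [CompleteSpace E] (f : R →ₗ[ℂ] E) (hf : ∃ C, ∀ x, ‖f x‖ ≤ C * p x) :
    ∃ F : p.Completion →L[ℂ] E, ∀ x, F (p.toCompletion x) = f x :=
  ⟨f.extendOfNorm p.toCompletion.toAlgHom.toLinearMap,
    LinearMap.extendOfNorm_eq p.denseRange_toCompletion
      (hf.imp fun _ hC x => (hC x).trans_eq (congrArg _ (p.norm_toCompletion x).symm))⟩

/-- A bounded linear functional which is positive on a dense ⋆-subalgebra extends to a positive
functional on the completion. -/
theorem exists_positive_extend (p : CStarSeminorm R) [PartialOrder p.Completion]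
    [StarOrderedRing p.Completion] (f : R →ₗ[ℂ] ℂ) (hf : ∃ C, ∀ x, ‖f x‖ ≤ C * p x)
    (hpos : ∀ x, 0 ≤ f (star x * x)) :
    ∃ F : p.Completion →ₚ[ℂ] ℂ, ∀ x, F (p.toCompletion x) = f x := by
  obtain ⟨F, hF⟩ := p.exists_extend f hf
  have key : ∀ y, 0 ≤ F (star y * y) := fun y => by
    refine p.denseRange_toCompletion.induction_on y
      (isClosed_le (by fun_prop) (by fun_prop)) fun x => ?_
    rw [← StarHomClass.map_star, ← map_mul, hF]
    exact hpos x
  refine ⟨PositiveLinearMap.mk₀ F.toLinearMap fun y hy => ?_, hF⟩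
  obtain ⟨x, rfl⟩ := CStarAlgebra.nonneg_iff_eq_star_mul_self.mp hy
  exact key x

theorem exists_starAlgHom_extend (p : CStarSeminorm R) {C : Type*} [CStarAlgebra C]
    (f : R →⋆ₐ[ℂ] C) (hf : ∀ x, ‖f x‖ ≤ p x) :
    ∃ F : p.Completion →⋆ₐ[ℂ] C, ∀ x, F (p.toCompletion x) = f x := by
  obtain ⟨F, hF⟩ := p.exists_extend f.toAlgHom.toLinearMap ⟨1, fun x => by simpa using hf x⟩
  replace hF : ∀ x, F (p.toCompletion x) = f x := hF
  have h1 : F 1 = 1 := by rw [← map_one p.toCompletion, hF, map_one]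
  refine ⟨{ toFun := F, map_one' := h1, map_mul' := fun x y => ?_, map_zero' := map_zero F,
            map_add' := map_add F, commutes' := fun r => ?_, map_star' := fun x => ?_ }, hF⟩
  · refine p.denseRange_toCompletion.induction_on₂ (p := fun x y => F (x * y) = F x * F y)
      (isClosed_eq (by fun_prop) (by fun_prop)) (fun a b => ?_) x y
    rw [← map_mul, hF, hF, hF, map_mul]
  · rw [Algebra.algebraMap_eq_smul_one, Algebra.algebraMap_eq_smul_one, map_smul, h1]
  · refine p.denseRange_toCompletion.induction_on x
      (isClosed_eq (F.continuous.comp continuous_star) (by fun_prop)) fun a => ?_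
    rw [← StarHomClass.map_star, hF, hF, StarHomClass.map_star]

end CStarSeminorm

end Extension

/-! ### Pulling back positive functionals -/

section Transport

variable {D : Type w} [CStarAlgebra D] {A : Type u} [CStarAlgebra A] {B : Type v} [CStarAlgebra B]

/-- If the representations of `A` are compressions along `T` of representations of `D`, and
`T (star d * d')` is a sum of squares, then positive functionals pull back along `T ⊗ id`. -/
theorem MinTensor.exists_pullback (T : D →ₗ[ℂ] A)
    (hT : ∀ (H : Type u) [NormedAddCommGroup H] [InnerProductSpace ℂ H] [CompleteSpace H]
      (π : A →⋆ₐ[ℂ] (H →L[ℂ] H)), ∃ (H' : Type u) (_ : NormedAddCommGroup H')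
      (_ : InnerProductSpace ℂ H') (_ : CompleteSpace H') (π' : D →⋆ₐ[ℂ] (H' →L[ℂ] H'))
      (W₁ W₂ : H →ₗᵢ[ℂ] H'), ∀ d x y, inner ℂ (W₁ x) (π' d (W₂ y)) = inner ℂ x (π (T d) y))
    {ι : Type*} [Fintype ι] (S : ι → D →ₗ[ℂ] A)
    (hS : ∀ d d', T (star d * d') = ∑ i, star (S i d) * S i d')
    (φ : MinTensor A B →ₚ[ℂ] ℂ) :
    ∃ ψ : MinTensor D B →ₚ[ℂ] ℂ, ∀ d b, ψ (MinTensor.tmul d b) = φ (MinTensor.tmul (T d) b) := by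
  have hsq : ∀ z : D ⊗[ℂ] B, T.rTensor B (star z * z) =
      ∑ i, star ((S i).rTensor B z) * (S i).rTensor B z := by
    -- The identity is not additive in `z`; its sesquilinear form is additive in each variable, so
    -- induction on tensors applies.
    suffices h : ∀ z z' : D ⊗[ℂ] B, T.rTensor B (star z * z') =
        ∑ i, star ((S i).rTensor B z) * (S i).rTensor B z' from fun z => h z z
    intro z z'
    induction z using TensorProduct.induction_on with
    | zero => simp
    | add z y hz hy => simp only [star_add, add_mul, map_add, hz, hy, Finset.sum_add_distrib]
    | tmul d b =>
      induction z' using TensorProduct.induction_on with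
      | zero => simp
      | add z y hz hy => simp only [mul_add, map_add, hz, hy, Finset.sum_add_distrib]
      | tmul d' b' => simp [hS, TensorProduct.sum_tmul]
  obtain ⟨C, hC⟩ := φ.exists_norm_apply_le
  obtain ⟨ψ, hψ⟩ := (minCStarNorm D B).exists_positive_extend
    (φ.toLinearMap ∘ₗ (minCStarNorm A B).toCompletion.toAlgHom.toLinearMap ∘ₗ T.rTensor B)
    ⟨C, fun z => (hC _).trans (mul_le_mul_of_nonneg_left
      (((minCStarNorm A B).norm_toCompletion _).trans_le (minCStarNorm_rTensor_le T hT z))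
      C.2)⟩
    fun z => by
      change 0 ≤ φ ((minCStarNorm A B).toCompletion (T.rTensor B (star z * z)))
      rw [hsq, map_sum]
      refine φ.map_nonneg (Finset.sum_nonneg fun i _ => ?_)
      rw [map_mul, map_star]
      exact star_mul_self_nonneg _
  exact ⟨ψ, fun d b => hψ (d ⊗ₜ b)⟩

theorem MinTensor.tmul_one_one : MinTensor.tmul (1 : A) (1 : B) = 1 :=
  map_one (minCStarNorm A B).toCompletion

/-- A representation `π` of `A` is trivially a compression of `π ∘ f`, and `f (d* d')` is the single
term `f(d)* f(d')`. -/
theorem MinTensor.exists_pullback_starAlgHom (f : D →⋆ₐ[ℂ] A) (φ : MinTensor A B →ₚ[ℂ] ℂ)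
    (hφ : φ 1 = 1) :
    ∃ ψ : MinTensor D B →ₚ[ℂ] ℂ, ψ 1 = 1 ∧
      ∀ d b, ψ (MinTensor.tmul d b) = φ (MinTensor.tmul (f d) b) := by
  obtain ⟨ψ, hψ⟩ := MinTensor.exists_pullback (B := B) f.toAlgHom.toLinearMap
    (fun H _ _ _ π => ⟨H, _, _, inferInstance, π.comp f, .id, .id, fun d x y => rfl⟩)
    (ι := Unit) (fun _ => f.toAlgHom.toLinearMap) (fun d d' => by simp [map_star]) φ
  refine ⟨ψ, ?_, hψ⟩
  rw [← tmul_one_one, hψ, ← hφ, ← tmul_one_one]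
  exact congrArg (fun a => φ (tmul a 1)) (map_one f)

end Transport

/-! ### The universal property of the PVM algebra -/

section Universal

/-- The involution reverses words and fixes letters, so self-adjointness of the images is what makes
the algebra lift compatible with `star`. -/
theorem FreeStarAlgebra.exists_lift {X : Type*} {C : Type*} [CStarAlgebra C] (g : X → C)
    (hg : ∀ x, IsSelfAdjoint (g x)) :
    ∃ f : FreeStarAlgebra X →⋆ₐ[ℂ] C, ∀ x, f (FreeStarAlgebra.gen x) = g x := by
  let f := MonoidAlgebra.lift ℂ C (FreeMonoid X) (FreeMonoid.lift g)
  have hw : ∀ w : FreeMonoid X, FreeMonoid.lift g (star w) = star (FreeMonoid.lift g w) := by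
    intro w
    induction w using FreeMonoid.inductionOn' with
    | one => simp
    | of_mul x w hw => simp [hw, (hg x).star_eq]
  refine ⟨{ toAlgHom := f, map_star' := fun x => ?_ }, fun x => ?_⟩
  · change f (star x) = star (f x)
    induction x using MonoidAlgebra.induction_linear with
    | zero => simp
    | add x y hx hy => rw [star_add, map_add, map_add, hx, hy, star_add]
    | single w c => simp [f, FreeStarAlgebra.star_single, hw]
  · change f _ = _
    simp [f, FreeStarAlgebra.gen]

/-- The universal property of `C⋆(m, k)`. -/
theorem PVMAlgebra.exists_starAlgHom {m k : ℕ} {C : Type*} [CStarAlgebra C]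
    (P : Fin k → Fin m → C) (hP : IsPVMFamily P) :
    ∃ f : PVMAlgebra m k →⋆ₐ[ℂ] C, ∀ a x, f (PVMAlgebra.proj a x) = P a x := by
  obtain ⟨f, hf⟩ := FreeStarAlgebra.exists_lift (fun i : Fin k × Fin m => P i.1 i.2)
    fun i => (hP.1 i.1 i.2).isSelfAdjoint
  -- The seminorm `‖f ·‖` kills the relations, hence lies below the universal one, and `f` extends
  -- to the completion.
  have hmem : CStarSeminorm.ofStarAlgHom f ∈ pvmSeminorms m k := by
    rintro _ (⟨a, x, rfl⟩ | ⟨x, rfl⟩)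
    · simp [hf, (hP.1 a x).isIdempotentElem.eq]
    · simp [hf, hP.2 x]
  obtain ⟨F, hF⟩ := (pvmUniversalSeminorm m k).exists_starAlgHom_extend f fun x =>
    le_csSup (bddAbove_pvmSeminorms m k x) ⟨_, hmem, rfl⟩
  exact ⟨F, fun a x => (hF _).trans (hf _)⟩

end Universal

/-! ### Matrix algebras and compression to an entry -/

section MatrixRep

namespace CStarMatrix

/-- The inclusion of `H` as a coordinate of `Hⁿ`. -/
def coordIsometry (H : Type*) [NormedAddCommGroup H] [InnerProductSpace ℂ H] {n : Type*} [Fintype n]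
    [DecidableEq n] (i : n) : H →ₗᵢ[ℂ] PiLp 2 (fun _ : n => H) where
  toLinearMap := (WithLp.linearEquiv 2 ℂ (n → H)).symm.toLinearMap ∘ₗ
    LinearMap.single ℂ (fun _ : n => H) i
  norm_map' x := PiLp.norm_single 2 (fun _ : n => H) i x

theorem coordIsometry_apply {H : Type*} [NormedAddCommGroup H] [InnerProductSpace ℂ H] {n : Type*}
    [Fintype n] [DecidableEq n] (i j : n) (x : H) :
    coordIsometry H i x j = if j = i then x else 0 := by
  change Pi.single (M := fun _ => H) i x j = _
  exact Pi.single_apply ..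

end CStarMatrix

variable {A : Type*} [CStarAlgebra A] {n : Type*} [Fintype n]
  {H : Type*} [NormedAddCommGroup H] [InnerProductSpace ℂ H] [CompleteSpace H]

namespace CStarMatrix

/-- The operator on `Hⁿ` given by a matrix over `A`, through a representation of `A` on `H`. -/
def toOp (π : A →⋆ₐ[ℂ] (H →L[ℂ] H)) (M : CStarMatrix n n A) :
    PiLp 2 (fun _ : n => H) →L[ℂ] PiLp 2 (fun _ : n => H) :=
  (PiLp.continuousLinearEquiv 2 ℂ (fun _ : n => H)).symm.toContinuousLinearMap ∘L
    ContinuousLinearMap.pi fun i => ∑ j, π (M i j) ∘L PiLp.proj 2 (fun _ : n => H) j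

theorem toOp_apply (π : A →⋆ₐ[ℂ] (H →L[ℂ] H)) (M : CStarMatrix n n A)
    (v : PiLp 2 (fun _ : n => H)) (i : n) : toOp π M v i = ∑ j, π (M i j) (v j) := by
  simp [toOp]

variable [DecidableEq n]

/-- The representation of the matrices over `A` on `Hⁿ`. -/
def rep (π : A →⋆ₐ[ℂ] (H →L[ℂ] H)) :
    CStarMatrix n n A →⋆ₐ[ℂ] (PiLp 2 (fun _ : n => H) →L[ℂ] PiLp 2 (fun _ : n => H)) where
  toFun := toOp π
  map_one' := by
    ext v i
    rw [toOp_apply, Finset.sum_eq_single i]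
    · simp
    · intro j _ hj; simp [one_apply_ne hj.symm]
    · simp
  map_mul' M N := by
    ext v i
    change _ = toOp π M (toOp π N v) i
    simp only [toOp_apply, mul_apply, map_sum, map_mul, sum_apply, mul_apply_eq_comp]
    exact Finset.sum_comm
  map_zero' := by ext v i; simp [toOp_apply]
  map_add' M N := by ext v i; simp [toOp_apply, Finset.sum_add_distrib]
  commutes' r := by
    ext v i
    rw [toOp_apply, Finset.sum_eq_single i]
    · simp [algebraMap_apply, Algebra.algebraMap_eq_smul_one]
    · intro j _ hj; simp [algebraMap_apply, hj.symm]
    · simp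
  map_star' M := by
    rw [ContinuousLinearMap.star_eq_adjoint, ContinuousLinearMap.eq_adjoint_iff]
    intro x y
    simp only [PiLp.inner_apply, toOp_apply, star_apply, map_star, sum_inner, inner_sum,
      ContinuousLinearMap.star_eq_adjoint, ContinuousLinearMap.adjoint_inner_left]
    exact Finset.sum_comm

/-- This supplies the dilation hypothesis of `MinTensor.exists_pullback` for an entry map. -/
theorem inner_rep (π : A →⋆ₐ[ℂ] (H →L[ℂ] H)) (M : CStarMatrix n n A) (i j : n) (x y : H) :
    inner ℂ (coordIsometry H i x) (rep π M (coordIsometry H j y)) =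
      inner ℂ x (π (M i j) y) := by
  change inner ℂ _ (toOp π M _) = _
  rw [PiLp.inner_apply, Finset.sum_eq_single i]
  · rw [toOp_apply, Finset.sum_eq_single j]
    · simp [coordIsometry_apply]
    · intro l _ hl; simp [coordIsometry_apply, hl]
    · simp
  · intro l _ hl; simp [coordIsometry_apply, hl]
  · simp

/-- A matrix entry, as a linear map. -/
def entry (A : Type*) [AddCommMonoid A] [Module ℂ A] {n : Type*} (i j : n) :
    CStarMatrix n n A →ₗ[ℂ] A where
  toFun M := M i j
  map_add' _ _ := rfl
  map_smul' _ _ := rfl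

theorem entry_apply {A : Type*} [AddCommMonoid A] [Module ℂ A] {n : Type*} (i j : n)
    (M : CStarMatrix n n A) : entry A i j M = M i j := rfl

end CStarMatrix

/-- A state on `A ⊗ B` extends to `Mₙ(A) ⊗ B` through the compression to a diagonal entry. -/
theorem MinTensor.exists_pullback_entry {A : Type u} [CStarAlgebra A] [PartialOrder A]
    [StarOrderedRing A] {n : Type} [Fintype n] [DecidableEq n] {B : Type v} [CStarAlgebra B]
    (i : n) (φ : MinTensor A B →ₚ[ℂ] ℂ) (hφ : φ 1 = 1) :
    ∃ ψ : MinTensor (CStarMatrix n n A) B →ₚ[ℂ] ℂ, ψ 1 = 1 ∧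
      ∀ M b, ψ (MinTensor.tmul M b) = φ (MinTensor.tmul (M i i) b) := by
  obtain ⟨ψ, hψ⟩ := MinTensor.exists_pullback (B := B) (CStarMatrix.entry A i i)
    (fun H _ _ _ π => ⟨PiLp 2 (fun _ : n => H), inferInstance, inferInstance, inferInstance,
      CStarMatrix.rep π, CStarMatrix.coordIsometry H i, CStarMatrix.coordIsometry H i,
      fun d x y => CStarMatrix.inner_rep π d i i x y⟩)
    -- Positivity comes from column `i`: `(M* N) i i = ∑ j, (M j i)* (N j i)`.
    (fun j : n => CStarMatrix.entry A j i)
    (fun M N => by simp only [CStarMatrix.entry_apply, CStarMatrix.mul_apply,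
      CStarMatrix.star_apply]) φ
  refine ⟨ψ, ?_, hψ⟩
  rw [← tmul_one_one, hψ, ← hφ, ← tmul_one_one]
  exact congrArg (fun a => φ (tmul a 1)) (CStarMatrix.one_apply_eq i)

end MatrixRep

/-! ### Naimark dilation by matrices -/

section Dilation

open Matrix

/-- The unitary completion of an isometry. -/
theorem Matrix.exists_unitary_fromBlocks {A : Type*} [Ring A] [StarRing A] {p q : Type*}
    [Fintype p] [Fintype q] [DecidableEq p] [DecidableEq q] (V : Matrix p q A)
    (hV : Vᴴ * V = 1) :
    ∃ U : Matrix (p ⊕ q) (q ⊕ p) A, Uᴴ * U = 1 ∧ U * Uᴴ = 1 ∧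
      ∀ j, (∀ i, U (.inl i) (.inl j) = V i j) ∧ ∀ i, U (.inr i) (.inl j) = 0 := by
  have h1 : (V * Vᴴ) * (V * Vᴴ) = V * Vᴴ := by
    rw [Matrix.mul_assoc, ← Matrix.mul_assoc Vᴴ, hV, Matrix.one_mul]
  have h2 : (1 - V * Vᴴ) * V = 0 := by
    rw [Matrix.sub_mul, Matrix.mul_assoc, hV, Matrix.one_mul, Matrix.mul_one, sub_self]
  have h3 : Vᴴ * (1 - V * Vᴴ) = 0 := by
    rw [Matrix.mul_sub, ← Matrix.mul_assoc, hV, Matrix.one_mul, Matrix.mul_one, sub_self]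
  have h4 : (1 - V * Vᴴ) * (1 - V * Vᴴ) = 1 - V * Vᴴ := by
    rw [mul_sub, sub_mul, sub_mul, h1]; simp
  -- The Halmos unitary of `V`; the lower left block is the defect `1 - V* V`, which vanishes for an
  -- isometry.
  refine ⟨fromBlocks V (1 - V * Vᴴ) 0 Vᴴ, ?_, ?_, fun j => ⟨fun i => rfl, fun i => rfl⟩⟩
  · rw [fromBlocks_conjTranspose, fromBlocks_multiply]
    simp [h2, h3, h4, hV]
  · rw [fromBlocks_conjTranspose, fromBlocks_multiply]
    simp [h2, h3, h4, hV]

/-- Every POVM with at least one outcome is the corner of a PVM of matrices. -/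
theorem Matrix.exists_pvm_dilation {A : Type*} [CStarAlgebra A] [PartialOrder A]
    [StarOrderedRing A] {k : ℕ} (M : Fin (k + 1) → A) (hM : ∀ a, 0 ≤ M a) (h1 : ∑ a, M a = 1) :
    ∃ P : Fin (k + 1) → Matrix (Unit ⊕ Fin (k + 1)) (Unit ⊕ Fin (k + 1)) A,
      (∀ a, IsStarProjection (P a)) ∧ ∑ a, P a = 1 ∧ ∀ a, P a (.inl ()) (.inl ()) = M a := by
  let V : Matrix (Fin (k + 1)) Unit A := .of fun a _ => CFC.sqrt (M a)
  have hs : ∀ a, star (CFC.sqrt (M a)) = CFC.sqrt (M a) := fun a =>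
    (IsSelfAdjoint.of_nonneg (CFC.sqrt_nonneg (M a))).star_eq
  obtain ⟨U, hU, hU', hUV⟩ := V.exists_unitary_fromBlocks (by
    ext ⟨⟩ ⟨⟩
    simp [V, Matrix.mul_apply, hs, CFC.sqrt_mul_sqrt_self, hM, h1])
  -- The diagonal projection for `a` selects row `a` of `U`. The extra row is assigned to outcome
  -- `0` so that the projections sum to `1`; this is where an outcome must exist. It does not affect
  -- the corner, since `U` vanishes there in the first column.
  let e : Fin (k + 1) → Fin (k + 1) ⊕ Unit → A := fun a =>
    Sum.elim (fun b => if b = a then 1 else 0) (fun _ => if 0 = a then 1 else 0)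
  have he : ∀ a, diagonal (e a) * diagonal (e a) = diagonal (e a) := fun a => by
    rw [diagonal_mul_diagonal]
    congr 1
    ext (b | _) <;> simp only [e, Sum.elim_inl, Sum.elim_inr] <;> split_ifs <;> simp
  have he' : ∀ a, (diagonal (e a))ᴴ = diagonal (e a) := fun a => by
    rw [diagonal_conjTranspose]
    congr 1
    ext (b | _) <;> simp only [e, Pi.star_apply, Sum.elim_inl, Sum.elim_inr] <;> split_ifs <;> simp
  have hsum : ∑ a, diagonal (e a) = 1 := by
    rw [← diagonal_one]
    ext i j
    rcases eq_or_ne i j with rfl | hij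
    · rcases i with b | _ <;> simp [Matrix.sum_apply, e]
    · simp [Matrix.sum_apply, hij]
  refine ⟨fun a => Uᴴ * diagonal (e a) * U, fun a => ⟨?_, ?_⟩, ?_, fun a => ?_⟩
  · change Uᴴ * diagonal (e a) * U * (Uᴴ * diagonal (e a) * U) = _
    calc _ = Uᴴ * (diagonal (e a) * (U * Uᴴ) * diagonal (e a)) * U := by
          simp only [Matrix.mul_assoc]
      _ = _ := by rw [hU', Matrix.mul_one, he]
  · change (Uᴴ * diagonal (e a) * U)ᴴ = Uᴴ * diagonal (e a) * U
    rw [conjTranspose_mul, conjTranspose_mul, conjTranspose_conjTranspose, he',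
      Matrix.mul_assoc]
  · rw [← Matrix.sum_mul, ← Matrix.mul_sum, hsum, Matrix.mul_one, hU]
  · change (Uᴴ * diagonal (e a) * U) (.inl ()) (.inl ()) = M a
    rw [Matrix.mul_apply]
    simp [Matrix.mul_diagonal, hUV, e, V, hs, CFC.sqrt_mul_sqrt_self, hM]

/-- Each setting `x` has its own unitary, but all share one matrix algebra and one corner, so a
single compression serves every setting. -/
theorem IsPOVMFamily.exists_pvm_dilation {A : Type u} [CStarAlgebra A] [PartialOrder A]
    [StarOrderedRing A] {k m : ℕ} {M : Fin (k + 1) → Fin m → A} (hM : IsPOVMFamily M) :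
    ∃ P : Fin (k + 1) → Fin m → CStarMatrix (Unit ⊕ Fin (k + 1)) (Unit ⊕ Fin (k + 1)) A,
      IsPVMFamily P ∧ ∀ a x, P a x (.inl ()) (.inl ()) = M a x := by
  choose P hP hP1 hPM using fun x =>
    Matrix.exists_pvm_dilation (fun a => M a x) (fun a => hM.1 a x) (hM.2 x)
  exact ⟨fun a x => CStarMatrix.ofMatrix (P x a),
    ⟨fun a x => ⟨(hP x a).isIdempotentElem, (hP x a).isSelfAdjoint⟩, hP1⟩, fun a x => hPM x a⟩

end Dilation

/-! ### Changing the universe of the algebra -/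

theorem IsPVMFamily.const {A : Type*} [CStarAlgebra A] {k m : ℕ} {P : Fin k → Fin m → A}
    (hP : IsPVMFamily P) (ι : Type*) [Fintype ι] : IsPVMFamily fun a x (_ : ι) => P a x :=
  ⟨fun a x => ⟨funext fun _ => (hP.1 a x).isIdempotentElem,
    funext fun _ => (hP.1 a x).isSelfAdjoint⟩,
    fun x => funext fun _ => by rw [Finset.sum_apply]; exact hP.2 x⟩

/-- Evaluation at a point is a ⋆-homomorphism `(ι → A) → A`. With `ι` a one-point type of a higher
universe, `ι → A` is a lifted copy of `A`. -/
theorem MinTensor.exists_pullback_const {A : Type u} [CStarAlgebra A] {B : Type v} [CStarAlgebra B]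
    (ι : Type w) [Fintype ι] [Nonempty ι] (φ : MinTensor A B →ₚ[ℂ] ℂ) (hφ : φ 1 = 1) :
    ∃ ψ : MinTensor (ι → A) B →ₚ[ℂ] ℂ, ψ 1 = 1 ∧
      ∀ a b, ψ (MinTensor.tmul (fun _ => a) b) = φ (MinTensor.tmul a b) := by
  obtain ⟨ψ, hψ, h⟩ := MinTensor.exists_pullback_starAlgHom (B := B)
    (Pi.evalStarAlgHom ℂ (fun _ : ι => A) (Classical.arbitrary ι)) φ hφ
  exact ⟨ψ, hψ, fun a b => h _ b⟩

end

/-! ### The equivalence -/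

theorem mainTheorem9 (m k : ℕ) {B : Type v} [CStarAlgebra B] [PartialOrder B]
    [StarOrderedRing B] (σ : Fin k → Fin m → (B →ₚ[ℂ] ℂ)) :
    List.TFAE [
      ∃ φ : MinTensor (PVMAlgebra m k) B →ₚ[ℂ] ℂ, φ 1 = 1 ∧
        ∀ a x b, σ a x b = φ (MinTensor.tmul (PVMAlgebra.proj a x) b),
      ∃ (A : Type u) (_ : CStarAlgebra A) (φ : MinTensor A B →ₚ[ℂ] ℂ) (P : Fin k → Fin m → A),
        φ 1 = 1 ∧ IsPVMFamily P ∧ ∀ a x b, σ a x b = φ (MinTensor.tmul (P a x) b),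
      ∃ (A : Type u) (_ : CStarAlgebra A) (_ : PartialOrder A) (_ : StarOrderedRing A)
        (φ : MinTensor A B →ₚ[ℂ] ℂ) (M : Fin k → Fin m → A),
        φ 1 = 1 ∧ IsPOVMFamily M ∧ ∀ a x b, σ a x b = φ (MinTensor.tmul (M a x) b)] := by
  tfae_have 1 → 2 := by
    rintro ⟨φ, hφ, hσ⟩
    -- `PVMAlgebra m k` lies in `Type`, while condition (2) asks for an algebra in `Type u`.
    obtain ⟨ψ, hψ, h⟩ := MinTensor.exists_pullback_const PUnit.{u + 1} φ hφ
    exact ⟨PUnit.{u + 1} → PVMAlgebra m k, inferInstance, ψ, fun a x _ => PVMAlgebra.proj a x, hψ,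
      PVMAlgebra.isPVMFamily_proj.const _, fun a x b => (hσ a x b).trans (h _ b).symm⟩
  tfae_have 2 → 1 := by
    rintro ⟨A, _, φ, P, hφ, hP, hσ⟩
    obtain ⟨f, hf⟩ := PVMAlgebra.exists_starAlgHom P hP
    obtain ⟨ψ, hψ, h⟩ := MinTensor.exists_pullback_starAlgHom f φ hφ
    exact ⟨ψ, hψ, fun a x b => by rw [hσ, h, hf]⟩
  tfae_have 2 → 3 := by
    rintro ⟨A, _, φ, P, hφ, hP, hσ⟩
    let _ := CStarAlgebra.spectralOrder A
    have _ := CStarAlgebra.spectralOrderedRing A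
    exact ⟨A, _, _, inferInstance, φ, P, hφ, ⟨fun a x => (hP.1 a x).nonneg, hP.2⟩, hσ⟩
  tfae_have 3 → 2 := by
    rintro ⟨A, _, _, _, φ, M, hφ, hM, hσ⟩
    rcases k with _ | k
    -- Without outcomes the projection condition is vacuous, so `M` is already a PVM family.
    · exact ⟨A, _, φ, M, hφ, ⟨fun a => a.elim0, hM.2⟩, hσ⟩
    · obtain ⟨P, hP, hPM⟩ := hM.exists_pvm_dilation
      obtain ⟨ψ, hψ, h⟩ := MinTensor.exists_pullback_entry
        (Sum.inl () : Unit ⊕ Fin (k + 1)) φ hφ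
      exact ⟨_, _, ψ, P, hψ, hP, fun a x b => by rw [hσ, h, hPM]⟩
  tfae_finish
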